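/- There are absolute constants $A,c>0$ and, for every $\kappa\in(0,1)$, a constant $C=C(\kappa)>0$ such that the following holds. Let $M,N,K$ be natural numbers with $1\le K\le \kappa N$ and $$M\ \ge\ C\,K\log(N/K).$$ Let $H$ be an $N\times N$ permutation matrix (for instance the switching matrix that sorts the entries of a signal in ascending order), let $\Psi$ be a real $N\times N$ orthogonal matrix (for instance the matrix of an orthonormal wavelet basis of $\mathbb{R}^N$), and let $\Phi$ be a random $M\times N$ matrix whose entries are independent Gaussian variables with mean $0$ and variance $1/M$. A vector $d\in\mathbb{R}^N$ is called $K$-sparse in the domain $H^{-1}\Psi$ if $d=H^{-1}\Psi x$ for some $x\in\mathbb{R}^N$ with at most $K$ nonzero entries. Then, with probability at least $1-A e^{-\gamma N}$, where $\gamma=c\,M/N>0$, every $d\in\mathbb{R}^N$ that is $K$-sparse in the domain $H^{-1}\Psi$ is recovered exactly from $y=\Phi d$ by the convex problem $$\min_{\hat x,\ \hat d}\ \|\hat x\|_{\ell_1}\quad\text{subject to}\quad y=\Phi\hat d,\quad \hat d=H^{-1}\Psi\hat x,$$ that is, this problem has a solution, and every solution $(\hat x,\hat d)$ satisfies $\hat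 d=d$. In particular, as long as $M/N\ge\rho>0$, the failure probability is at most $Ae^{-c\rho N}=O(e^{-\gamma N})$ with $\gamma=c\rho$ depending only on $\rho$. -/

import Mathlib

open MeasureTheory ProbabilityTheory
open scoped NNReal ENNReal

/-- `d` is `K`-sparse in the domain `B`: `d = B x` for some `x` with at most `K` nonzero entries. -/
def IsSparseIn {N : ℕ} (K : ℕ) (B : Matrix (Fin N) (Fin N) ℝ) (d : Fin N → ℝ) : Prop :=
  ∃ x : Fin N → ℝ, d = B.mulVec x ∧ (Finset.univ.filter fun i => x i ≠ 0).card ≤ K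

/-- The constraints `y = Φ d`, `d = B x` of the optimization problem. -/
def IsFeasible {M N : ℕ} (Φ : Matrix (Fin M) (Fin N) ℝ) (B : Matrix (Fin N) (Fin N) ℝ)
    (y : Fin M → ℝ) (x d : Fin N → ℝ) : Prop :=
  y = Φ.mulVec d ∧ d = B.mulVec x

/-- `(x, d)` solves: minimize `‖x‖₁` subject to `y = Φ d`, `d = B x`. -/
def IsL1Minimizer {M N : ℕ} (Φ : Matrix (Fin M) (Fin N) ℝ) (B : Matrix (Fin N) (Fin N) ℝ)
    (y : Fin M → ℝ) (x d : Fin N → ℝ) : Prop :=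
  IsFeasible Φ B y x d ∧
    ∀ x' d' : Fin N → ℝ, IsFeasible Φ B y x' d' → ∑ i, |x i| ≤ ∑ i, |x' i|

/-- From the measurements `y = Φ d`, the `ℓ₁` problem returns exactly `d`: it has a solution,
and the signal component of every solution is `d`. -/
def RecoversExactly {M N : ℕ} (Φ : Matrix (Fin M) (Fin N) ℝ) (B : Matrix (Fin N) (Fin N) ℝ)
    (d : Fin N → ℝ) : Prop :=
  (∃ x d' : Fin N → ℝ, IsL1Minimizer Φ B (Φ.mulVec d) x d') ∧
    ∀ x d' : Fin N → ℝ, IsL1Minimizer Φ B (Φ.mulVec d) x d' → d' = d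

/-- `Φ` is a random `M × N` matrix with i.i.d. entries of law `N(0, 1/M)`. -/
structure IsGaussianSensing {Ω : Type*} [MeasurableSpace Ω] (μ : Measure Ω) {M N : ℕ}
    (Φ : Ω → Matrix (Fin M) (Fin N) ℝ) : Prop where
  hasLaw : ∀ i j, HasLaw (fun ω => Φ ω i j) (gaussianReal 0 (1 / (M : ℝ≥0))) μ
  indep : iIndepFun (fun (p : Fin M × Fin N) (ω : Ω) => Φ ω p.1 p.2) μ

/-!
Write `B = H⁻¹Ψ`, an orthogonal matrix, and `|·|₂`, `|·|₁` for the Euclidean and the `ℓ₁` norm.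
Exact recovery of all `K`-sparse signals follows from the null space property
(`recoversExactly_of_nullSpaceProperty`): no nonzero `v` with `ΦBv = 0` satisfies
`|v_{Sᶜ}|₁ ≤ |v_S|₁` for a set `S` of at most `K` indices. Such a `v` would lie in the cone
`|v|₁ ≤ 2√K |v|₂` (`sum_abs_le_of_sum_compl_le`), so it is enough that `ΦB` has no kernel in this
cone.

Instead of nets on the subspaces of sparse vectors, the proof uses the integer points of the `ℓ₁` ball
of radius `R = 80000 K`. On the event that `|z|₂ / 6 ≤ |ΦBz|₂ ≤ 3 |z|₂` for all such integer points `z`,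
the kernel meets the cone only in `0` (`eq_zero_of_lattice_bounds`):

* The upper bound on vectors with entries in `{-1, 0, 1}` and support of size at most `s` extends,
  by convexity of the seminorm and because a cube is the convex hull of its vertices, to all vectors
  supported on `s` coordinates; splitting off the `s` largest entries repeatedly gives
  `|ΦBu|₂ ≤ 3√s (|u|_∞ + |u|₁ / s)` for every `u` (`Seminorm.le_of_flat_of_sum`).
* If `v` lies in the cone and in the kernel, rounding `v` towards `0` on the lattice `δℤ^N` with
  `δ = |v|₂ / (40000 √K)` gives `v = δz + u`, where `|z|₁ ≤ R` and `u` is small in the sense of the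
  previous bound with `s = 40000 K`. Since `ΦB(δz) = -ΦBu`, the lower bound makes `δz` short, and so
  `v` is shorter than itself.

For a fixed `z` the entries of `ΦBz` are independent Gaussian variables of variance `|z|₂² / M`, and
the Chernoff bound shows that each of the two inequalities fails with probability at most `e^{-M}`
(`measure_gaussian_mulVec_tails_le`). The number of integer points is at most
`x^R (1 + 2 / (x - 1))^N` for every `x > 1` (`card_latticeL1Ball_le`), which for `x = 1 + 2N/K` is of
the form `exp (O(K (1 + log (N/K))))`, hence at most `e^{M/2}` when `M ≥ C(κ) K log (N/K)`. The union
bound gives failure probability at most `2 e^{-M/2}`.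
-/

/-! ### Sums of squares of Gaussian variables -/

lemma mgf_sq_gaussianReal {Ω : Type*} [MeasurableSpace Ω] {μ : Measure Ω} {X : Ω → ℝ} {v : ℝ≥0}
    (hv : v ≠ 0) (hX : HasLaw X (gaussianReal 0 v) μ) (s : ℝ) :
    mgf (fun ω => X ω ^ 2) μ (s / v) = (√(1 - 2 * s))⁻¹ := by
  have hv' : (0 : ℝ) < v := by positivity
  have h1 : mgf (fun ω => X ω ^ 2) μ (s / v)
      = ∫ x, Real.exp (s / v * x ^ 2) ∂(gaussianReal 0 v) := by
    rw [← hX.map_eq, integral_map hX.aemeasurable (by fun_prop)]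
    rfl
  rw [h1, integral_gaussianReal_eq_integral_smul hv]
  have h2 : ∀ x : ℝ, gaussianPDFReal 0 v x • Real.exp (s / v * x ^ 2)
      = (√(2 * Real.pi * v))⁻¹ * Real.exp (-((1 - 2 * s) / (2 * v)) * x ^ 2) := by
    intro x
    rw [gaussianPDFReal_def, smul_eq_mul, mul_assoc, ← Real.exp_add]
    congr 2
    field_simp
    ring
  simp_rw [h2]
  rw [integral_const_mul, integral_gaussian, ← Real.sqrt_inv, ← Real.sqrt_mul (by positivity),
    ← Real.sqrt_inv]
  congr 1
  field_simp

lemma hasLaw_sum_mul_gaussianReal {Ω ι : Type*} [Fintype ι] [MeasurableSpace Ω] {μ : Measure Ω}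
    {X : ι → Ω → ℝ} {v : ℝ≥0} (hX : ∀ j, HasLaw (X j) (gaussianReal 0 v) μ)
    (hind : iIndepFun X μ) (w : ι → ℝ) :
    HasLaw (fun ω => ∑ j, X j ω * w j) (gaussianReal 0 (v * ∑ j, ‖w j‖₊ ^ 2)) μ := by
  have := hind.isProbabilityMeasure
  have hY : ∀ j, HasLaw (fun ω => X j ω * w j) (gaussianReal 0 (‖w j‖₊ ^ 2 * v)) μ := by
    intro j
    convert gaussianReal_mul_const (hX j) (w j) using 2
    · simp
    · congr 1
      ext
      simp
  have hYind : iIndepFun (fun j ω => X j ω * w j) μ :=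
    hind.comp (fun j x => x * w j) (fun j => by fun_prop)
  have haem : ∀ j, AEMeasurable (fun ω => X j ω * w j) μ := fun j => (hY j).aemeasurable
  refine ⟨by fun_prop, ?_⟩
  have : IsProbabilityMeasure (μ.map fun ω => ∑ j, X j ω * w j) :=
    Measure.isProbabilityMeasure_map (by fun_prop)
  apply Measure.ext_of_charFun
  rw [hYind.charFun_map_fun_sum_eq_prod haem]
  ext t
  rw [Finset.prod_apply, charFun_gaussianReal]
  simp_rw [(hY _).map_eq, charFun_gaussianReal, ← Complex.exp_sum]
  congr 1
  push_cast
  simp only [Finset.mul_sum, Finset.sum_mul, Finset.sum_div, mul_zero, zero_mul, zero_sub,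
    Finset.sum_neg_distrib]
  congr 1
  exact Finset.sum_congr rfl fun j _ => by ring

/-- The rows of a matrix with independent Gaussian entries are independent, because they are jointly
Gaussian and uncorrelated; hence so are the entries of its product with a fixed vector. -/
lemma iIndepFun_rows_mulVec {Ω ι κ : Type*} [Fintype ι] [Fintype κ] [MeasurableSpace Ω]
    {μ : Measure Ω} {Φ : Ω → Matrix ι κ ℝ} {v : ℝ≥0}
    (hlaw : ∀ i j, HasLaw (fun ω => Φ ω i j) (gaussianReal 0 v) μ)
    (hind : iIndepFun (fun (p : ι × κ) (ω : Ω) => Φ ω p.1 p.2) μ) (w : κ → ℝ) :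
    iIndepFun (fun i ω => (Φ ω).mulVec w i) μ := by
  have hG : HasGaussianLaw (fun ω (p : ι × κ) => Φ ω p.1 p.2) μ :=
    hind.hasGaussianLaw fun p => (hlaw p.1 p.2).hasGaussianLaw
  have hG' : HasGaussianLaw (fun ω (i : ι) (j : κ) => Φ ω i j) μ := by
    let L : (ι × κ → ℝ) →L[ℝ] (ι → κ → ℝ) :=
      ContinuousLinearMap.pi fun i => ContinuousLinearMap.pi fun j =>
        ContinuousLinearMap.proj (i, j)
    exact hG.map_fun L
  have hrow : iIndepFun (fun i ω j => Φ ω i j) μ := by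
    refine HasGaussianLaw.iIndepFun_of_covariance_eval (X := fun i j ω => Φ ω i j) hG'
      fun i i' hii' k l => ?_
    have hne : ((i, k) : ι × κ) ≠ (i', l) := fun h => hii' (congrArg Prod.fst h)
    exact (hind.indepFun hne).covariance_eq_zero (hlaw i k).hasGaussianLaw.memLp_two
      (hlaw i' l).hasGaussianLaw.memLp_two
  exact hrow.comp (fun _ r => ∑ j, r j * w j) fun _ => by fun_prop

lemma mgf_sum_sq_gaussianReal {Ω ι : Type*} [Fintype ι] [MeasurableSpace Ω] {μ : Measure Ω}
    {Y : ι → Ω → ℝ} {v : ℝ≥0} (hv : v ≠ 0) (hY : ∀ i, HasLaw (Y i) (gaussianReal 0 v) μ)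
    (hind : iIndepFun Y μ) (s : ℝ) :
    mgf (fun ω => ∑ i, Y i ω ^ 2) μ (s / v) = (√(1 - 2 * s))⁻¹ ^ Fintype.card ι := by
  have hsq : iIndepFun (fun i ω => Y i ω ^ 2) μ :=
    hind.comp (fun _ x => x ^ 2) fun _ => by fun_prop
  have haem : ∀ i, AEMeasurable (fun ω => Y i ω ^ 2) μ := fun i =>
    (hY i).aemeasurable.pow_const 2
  have := hsq.mgf_sum₀ (t := s / v) haem Finset.univ
  simp only [mgf_sq_gaussianReal hv (hY _), Finset.prod_const, Finset.card_univ] at this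
  rw [← this]
  congr 1
  ext ω
  simp

/-- Upper tail of a chi-squared variable: the Chernoff bound at the parameter `1 / (4 v)`. -/
lemma measureReal_sum_sq_gaussianReal_ge {Ω ι : Type*} [Fintype ι] [MeasurableSpace Ω]
    {μ : Measure Ω}
    {Y : ι → Ω → ℝ} {v : ℝ≥0} (hv : v ≠ 0) (hY : ∀ i, HasLaw (Y i) (gaussianReal 0 v) μ)
    (hind : iIndepFun Y μ) :
    μ.real {ω | 9 * (v * Fintype.card ι) ≤ ∑ i, Y i ω ^ 2} ≤ Real.exp (-Fintype.card ι) := by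
  have := hind.isProbabilityMeasure
  have hv' : (0 : ℝ) < v := by positivity
  have hm := mgf_sum_sq_gaussianReal hv hY hind (1 / 4)
  -- A positive moment generating function certifies integrability: a divergent integral is `0`.
  have hint : Integrable (fun ω => Real.exp (1 / 4 / v * ∑ i, Y i ω ^ 2)) μ := by
    refine mgf_pos_iff.1 ?_
    rw [hm]
    have : (0 : ℝ) < √(1 - 2 * (1 / 4)) := Real.sqrt_pos.2 (by norm_num)
    positivity
  refine (measure_ge_le_exp_mul_mgf _ (by positivity) hint).trans ?_
  rw [hm]
  have h1 : -(1 / 4 / (v : ℝ)) * (9 * (v * Fintype.card ι)) = Fintype.card ι * (-9 / 4) := by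
    field_simp
  have h2 : (-(Fintype.card ι : ℝ)) = Fintype.card ι * (-1) := by ring
  rw [h1, h2, Real.exp_nat_mul, Real.exp_nat_mul, ← mul_pow]
  refine pow_le_pow_left₀ (by positivity) ?_ _
  have h3 : (√(1 - 2 * (1 / 4)))⁻¹ ≤ (2 : ℝ) := by
    rw [inv_le_comm₀ (Real.sqrt_pos.2 (by norm_num)) (by norm_num)]
    exact Real.le_sqrt_of_sq_le (by norm_num)
  have h4 : (2 : ℝ) ≤ Real.exp (5 / 4) := by
    have := Real.add_one_le_exp (5 / 4 : ℝ)
    linarith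
  calc Real.exp (-9 / 4) * (√(1 - 2 * (1 / 4)))⁻¹ ≤ Real.exp (-9 / 4) * Real.exp (5 / 4) := by
        gcongr; exact h3.trans h4
    _ = Real.exp (-1) := by rw [← Real.exp_add]; norm_num

/-- Lower tail of a chi-squared variable: the Chernoff bound at the parameter `-36 / v`. The
threshold `1 / 36` makes the exponential factor `e` per variable, against a moment generating
function of `73 ^ (-1/2) < e⁻²`. -/
lemma measureReal_sum_sq_gaussianReal_le {Ω ι : Type*} [Fintype ι] [MeasurableSpace Ω]
    {μ : Measure Ω}
    {Y : ι → Ω → ℝ} {v : ℝ≥0} (hv : v ≠ 0) (hY : ∀ i, HasLaw (Y i) (gaussianReal 0 v) μ)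
    (hind : iIndepFun Y μ) :
    μ.real {ω | ∑ i, Y i ω ^ 2 ≤ v * Fintype.card ι / 36} ≤ Real.exp (-Fintype.card ι) := by
  have := hind.isProbabilityMeasure
  have hv' : (0 : ℝ) < v := by positivity
  have hm := mgf_sum_sq_gaussianReal hv hY hind (-36)
  have hint : Integrable (fun ω => Real.exp (-36 / v * ∑ i, Y i ω ^ 2)) μ := by
    refine mgf_pos_iff.1 ?_
    rw [hm]
    have : (0 : ℝ) < √(1 - 2 * (-36)) := Real.sqrt_pos.2 (by norm_num)
    positivity
  refine (measure_le_le_exp_mul_mgf _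
    (div_nonpos_of_nonpos_of_nonneg (by norm_num) hv'.le) hint).trans ?_
  rw [hm]
  have h1 : -(-36 / (v : ℝ)) * (v * Fintype.card ι / 36) = Fintype.card ι * 1 := by
    field_simp
  have h2 : (-(Fintype.card ι : ℝ)) = Fintype.card ι * (-1) := by ring
  rw [h1, h2, Real.exp_nat_mul, Real.exp_nat_mul, ← mul_pow]
  refine pow_le_pow_left₀ (by positivity) ?_ _
  have h3 : (√(1 - 2 * (-36)))⁻¹ ≤ Real.exp (-2) := by
    rw [Real.exp_neg]
    refine inv_anti₀ (Real.exp_pos _) (Real.le_sqrt_of_sq_le ?_)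
    have he : Real.exp 2 = Real.exp 1 ^ 2 := by rw [← Real.exp_nat_mul]; norm_num
    have h5 : Real.exp 1 ≤ 2.8 := (Real.exp_one_lt_d9.trans (by norm_num)).le
    calc Real.exp 2 ^ 2 = Real.exp 1 ^ 4 := by rw [he]; ring
      _ ≤ 2.8 ^ 4 := by gcongr
      _ ≤ 1 - 2 * (-36) := by norm_num
  calc Real.exp 1 * (√(1 - 2 * (-36)))⁻¹ ≤ Real.exp 1 * Real.exp (-2) := by
        gcongr
    _ = Real.exp (-1) := by rw [← Real.exp_add]; norm_num

/-! ### From lattice bounds to the null space property -/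

/-- A vector with entries bounded by `b` on `s` coordinates and zero elsewhere is a convex combination
of the vertices `b • z` of a cube, `z` having entries in `{-1, 0, 1}`; a seminorm is at most its
largest value at the vertices. -/
lemma Seminorm.le_of_flat {ι : Type*} [Fintype ι] (p : Seminorm ℝ (ι → ℝ)) {s : ℕ} {a : ℝ}
    (hflat : ∀ z : ι → ℤ, (∀ i, |z i| ≤ 1) → ∑ i, |z i| ≤ s → p (fun i => (z i : ℝ)) ≤ a)
    {u : ι → ℝ} {b : ℝ} (hb : 0 ≤ b) (hu : ∀ i, |u i| ≤ b) {I : Finset ι} (hI : I.card ≤ s)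
    (hsupp : ∀ i, i ∉ I → u i = 0) : p u ≤ b * a := by
  classical
  rcases hb.eq_or_lt with rfl | hb
  · have : u = 0 := funext fun i => abs_nonpos_iff.1 (hu i)
    simp [this]
  let t : ι → Set ℝ := fun i => if i ∈ I then {-1, 1} else {0}
  have hmem : b⁻¹ • u ∈ convexHull ℝ (Set.univ.pi t) := by
    rw [convexHull_pi]
    intro i _
    by_cases hi : i ∈ I
    · have h := abs_le.1 (hu i)
      simp only [t, hi, if_true, convexHull_pair, segment_eq_Icc (show (-1 : ℝ) ≤ 1 by norm_num),
        Pi.smul_apply, smul_eq_mul, Set.mem_Icc, ← div_eq_inv_mul, div_le_one hb, le_div_iff₀ hb]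
      exact ⟨by linarith, h.2⟩
    · simp [t, hi, hsupp i hi]
  obtain ⟨y, hy, hle⟩ := p.convexOn.exists_ge_of_mem_convexHull (Set.subset_univ _) hmem
  have hz : ∀ i, ∃ k : ℤ, (k : ℝ) = y i ∧ |k| ≤ if i ∈ I then 1 else 0 := by
    intro i
    have := hy i trivial
    by_cases hi : i ∈ I
    · simp only [t, hi, if_true, Set.mem_insert_iff, Set.mem_singleton_iff] at this ⊢
      rcases this with h | h
      · exact ⟨-1, by simp [h], by simp⟩
      · exact ⟨1, by simp [h], by simp⟩
    · simp only [t, hi, if_false, Set.mem_singleton_iff] at this ⊢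
      exact ⟨0, by simp [this], by simp⟩
  choose z hzy hz1 using hz
  have hpy : p y ≤ a := by
    rw [show y = fun i => (z i : ℝ) from funext fun i => (hzy i).symm]
    refine hflat z (fun i => (hz1 i).trans (by split_ifs <;> simp)) ?_
    calc ∑ i, |z i| ≤ ∑ i, (if i ∈ I then (1 : ℤ) else 0) := Finset.sum_le_sum fun i _ => hz1 i
      _ = I.card := by simp
      _ ≤ s := by exact_mod_cast hI
  calc p u = p (b • b⁻¹ • u) := by rw [smul_inv_smul₀ hb.ne']
    _ = b * p (b⁻¹ • u) := by rw [map_smul_eq_mul, Real.norm_of_nonneg hb.le]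
    _ ≤ b * a := by gcongr; exact hle.trans hpy

/-- The set `I` consists of `s` indices with the largest values (of all indices if there are fewer
than `s`). -/
lemma exists_finset_card_mul_le_sum {ι : Type*} [Fintype ι] (u : ι → ℝ) (s : ℕ) : ∃ I : Finset ι, I.card ≤ s ∧ ∀ i, i ∉ I → s * u i ≤ ∑ j ∈ I, u j := by
  classical
  rcases le_or_gt (Fintype.card ι) s with h | h
  · exact ⟨Finset.univ, h, by simp⟩
  have key : ∀ n ≤ Fintype.card ι, ∃ I : Finset ι, I.card = n ∧
      ∀ i, i ∉ I → ∀ j ∈ I, u i ≤ u j := by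
    intro n
    induction n with
    | zero => exact fun _ => ⟨∅, by simp⟩
    | succ n ih =>
      intro hn
      obtain ⟨I, hI, hle⟩ := ih (by omega)
      have hne : (Iᶜ).Nonempty := by
        rw [← Finset.card_pos, Finset.card_compl]
        omega
      obtain ⟨k, hk, hmax⟩ := Finset.exists_max_image Iᶜ u hne
      have hkI : k ∉ I := Finset.mem_compl.1 hk
      refine ⟨insert k I, by rw [Finset.card_insert_of_notMem hkI, hI], fun i hi j hj => ?_⟩
      rw [Finset.mem_insert, not_or] at hi
      rcases Finset.mem_insert.1 hj with rfl | hj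
      · exact hmax i (Finset.mem_compl.2 hi.2)
      · exact hle i hi.2 j hj
  obtain ⟨I, hI, hle⟩ := key s h.le
  refine ⟨I, hI.le, fun i hi => ?_⟩
  rw [← hI, ← nsmul_eq_mul]
  exact Finset.card_nsmul_le_sum _ _ _ fun j hj => hle i hi j hj

/-- Bounds on flat vectors control a seminorm everywhere. The largest `s` entries of `u` contribute at
most `b * a`, and the remaining ones are bounded by the average of these `s` entries, so that
repeating this on the remainder produces a telescoping sum of such averages. -/
lemma Seminorm.le_of_flat_of_sum {ι : Type*} [Fintype ι] (p : Seminorm ℝ (ι → ℝ)) {s : ℕ}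
    (hs : 0 < s) {a : ℝ} (ha : 0 ≤ a)
    (hflat : ∀ z : ι → ℤ, (∀ i, |z i| ≤ 1) → ∑ i, |z i| ≤ s → p (fun i => (z i : ℝ)) ≤ a)
    (u : ι → ℝ) {b : ℝ} (hb : 0 ≤ b) (hu : ∀ i, |u i| ≤ b) :
    p u ≤ (b + (∑ i, |u i|) / s) * a := by
  classical
  have hs' : (0 : ℝ) < s := by exact_mod_cast hs
  induction hn : (Finset.univ.filter fun i => u i ≠ 0).card using Nat.strong_induction_on
    generalizing u b with
  | _ n ih =>
  by_cases h0 : u = 0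
  · have : 0 ≤ (b + (∑ i, |u i|) / s) * a := by positivity
    simpa [h0] using this
  obtain ⟨I, hI, htop⟩ := exists_finset_card_mul_le_sum (fun i => |u i|) s
  let u₁ : ι → ℝ := fun i => if i ∈ I then u i else 0
  let u₂ : ι → ℝ := fun i => if i ∈ I then 0 else u i
  have hadd : u = u₁ + u₂ := by
    ext i
    by_cases hi : i ∈ I <;> simp [u₁, u₂, hi]
  have h1 : p u₁ ≤ b * a := by
    refine p.le_of_flat hflat hb (fun i => ?_) hI (fun i hi => by simp [u₁, hi])
    by_cases hi : i ∈ I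
    · simpa [u₁, hi] using hu i
    · simpa [u₁, hi] using hb
  have hmeet : ∃ j ∈ I, u j ≠ 0 := by
    by_contra! hno
    refine h0 (funext fun i => ?_)
    by_cases hi : i ∈ I
    · exact hno i hi
    have := htop i hi
    rw [Finset.sum_eq_zero fun j hj => by rw [hno j hj, abs_zero]] at this
    exact abs_nonpos_iff.1 (nonpos_of_mul_nonpos_right this hs')
  have hcard : (Finset.univ.filter fun i => u₂ i ≠ 0).card < n := by
    rw [← hn]
    refine Finset.card_lt_card (Finset.ssubset_iff_of_subset ?_ |>.2 ?_)
    · intro i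
      by_cases hi : i ∈ I <;> simp [u₂, hi]
    · obtain ⟨j, hj, hj0⟩ := hmeet
      exact ⟨j, by simp [hj0], by simp [u₂, hj]⟩
  have h2 := ih _ hcard u₂ (b := (∑ j ∈ I, |u j|) / s) (by positivity) (fun i => by
    by_cases hi : i ∈ I
    · simp only [u₂, hi, if_true, abs_zero]
      positivity
    · simp only [u₂, hi, if_false]
      rw [le_div_iff₀' hs']
      exact htop i hi) rfl
  have hsum : ∑ i, |u i| = ∑ j ∈ I, |u j| + ∑ i, |u₂ i| := by
    rw [← Finset.sum_add_sum_compl I, ← Finset.sum_add_sum_compl I fun i => |u₂ i|,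
      Finset.sum_eq_zero (s := I) (f := fun i => |u₂ i|) fun i hi => by simp [u₂, hi], zero_add]
    congr 1
    exact Finset.sum_congr rfl fun i hi => by simp [u₂, Finset.mem_compl.1 hi]
  calc p u ≤ p u₁ + p u₂ := by
        conv_lhs => rw [hadd]
        exact map_add_le_add p _ _
    _ ≤ b * a + ((∑ j ∈ I, |u j|) / s + (∑ i, |u₂ i|) / s) * a := add_le_add h1 h2
    _ = (b + (∑ i, |u i|) / s) * a := by rw [hsum]; ring

/-- Rounding towards zero. -/
lemma exists_int_truncation (x : ℝ) : ∃ k : ℤ, |(k : ℝ)| ≤ |x| ∧ |x - k| ≤ |x| ∧ |x - k| ≤ 1 := by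
  have key : ∀ y : ℝ, 0 ≤ y → ∃ k : ℤ, |(k : ℝ)| ≤ |y| ∧ |y - k| ≤ |y| ∧ |y - k| ≤ 1 := by
    intro y hy
    have h1 := Int.floor_le y
    have h2 := (Int.lt_floor_add_one y).le
    have h3 : (0 : ℝ) ≤ ⌊y⌋ := by exact_mod_cast Int.floor_nonneg.2 hy
    refine ⟨⌊y⌋, ?_⟩
    rw [abs_of_nonneg h3, abs_of_nonneg hy, abs_of_nonneg (sub_nonneg.2 h1)]
    exact ⟨h1, by linarith, by linarith⟩
  rcases le_total 0 x with hx | hx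
  · exact key x hx
  · obtain ⟨k, h1, h2, h3⟩ := key (-x) (by linarith)
    refine ⟨-k, ?_⟩
    have : |x - ((-k : ℤ) : ℝ)| = |-x - k| := by
      rw [← abs_neg]
      push_cast
      congr 1
      ring
    rw [this]
    simp only [abs_neg] at h1 h2
    exact ⟨by simpa using h1, h2, h3⟩

/-- If a seminorm is comparable to the Euclidean norm on the integer points of the `ℓ₁` ball of
radius `80000 K`, then its kernel meets the cone `|v|₁ ≤ 2√K |v|₂` only in `0`. -/
lemma eq_zero_of_lattice_bounds {ι : Type*} [Fintype ι] (p : Seminorm ℝ (ι → ℝ)) {K : ℕ}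
    (hK : 1 ≤ K)
    (hp : ∀ z : ι → ℤ, ∑ i, |z i| ≤ ((80000 * K : ℕ) : ℤ) →
      √(∑ i, (z i : ℝ) ^ 2) / 6 ≤ p (fun i => (z i : ℝ)) ∧
        p (fun i => (z i : ℝ)) ≤ 3 * √(∑ i, (z i : ℝ) ^ 2))
    {v : ι → ℝ} (hv : p v = 0) (hcone : ∑ i, |v i| ≤ 2 * √K * √(∑ i, v i ^ 2)) : v = 0 := by
  have hK' : (0 : ℝ) < √K := Real.sqrt_pos.2 (by exact_mod_cast hK)
  have hKsq : √(K : ℝ) ^ 2 = K := Real.sq_sqrt (Nat.cast_nonneg K)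
  set n := √(∑ i, v i ^ 2) with hn
  have hnsq : n ^ 2 = ∑ i, v i ^ 2 := Real.sq_sqrt (Finset.sum_nonneg fun i _ => sq_nonneg _)
  rcases (Real.sqrt_nonneg (∑ i, v i ^ 2)).eq_or_lt with h0 | hnpos
  · rw [← hn] at h0
    rw [← h0, zero_pow two_ne_zero, eq_comm,
      Finset.sum_eq_zero_iff_of_nonneg fun i _ => sq_nonneg _] at hnsq
    exact funext fun i => pow_eq_zero_iff two_ne_zero |>.1 (hnsq i (Finset.mem_univ i))
  rw [← hn] at hnpos
  exfalso
  -- This mesh makes the rounded vector `z` have `ℓ₁` norm at most `|v|₁ / δ ≤ 80000 K`.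
  set δ := n / (40000 * √K) with hδ
  have hδpos : 0 < δ := by positivity
  choose z hz1 hz2 hz3 using fun i => exists_int_truncation (v i / δ)
  let u : ι → ℝ := fun i => v i - δ * z i
  have hu : ∀ i, |u i| = δ * |v i / δ - z i| := by
    intro i
    rw [← abs_of_pos hδpos, ← abs_mul, abs_of_pos hδpos]
    congr 1
    simp only [u]
    field_simp
  have hu1 : ∀ i, |u i| ≤ δ := fun i => by
    rw [hu]
    exact mul_le_of_le_one_right hδpos.le (hz3 i)
  have hvd : ∀ i, δ * |v i / δ| = |v i| := fun i => by
    rw [abs_div, abs_of_pos hδpos]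
    field_simp
  have hu2 : ∀ i, |u i| ≤ |v i| := fun i => by
    rw [hu, ← hvd i]
    exact mul_le_mul_of_nonneg_left (hz2 i) hδpos.le
  have husum : ∑ i, |u i| ≤ 2 * √K * n :=
    (Finset.sum_le_sum fun i _ => hu2 i).trans hcone
  have hzsum : ∑ i, |z i| ≤ ((80000 * K : ℕ) : ℤ) := by
    have : (∑ i, |(z i : ℝ)|) ≤ 80000 * K := by
      calc (∑ i, |(z i : ℝ)|) ≤ ∑ i, |v i| / δ := by
            refine Finset.sum_le_sum fun i _ => ?_
            have := hz1 i
            rwa [abs_div, abs_of_pos hδpos] at this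
        _ = (∑ i, |v i|) / δ := by rw [Finset.sum_div]
        _ ≤ 2 * √K * n / δ := by gcongr
        _ = 80000 * √K ^ 2 := by rw [hδ]; field_simp; norm_num
        _ = 80000 * K := by rw [hKsq]
    exact_mod_cast this
  -- For entries in `{-1, 0, 1}` the squared Euclidean norm is the `ℓ₁` norm.
  have hflat : ∀ y : ι → ℤ, (∀ i, |y i| ≤ 1) → ∑ i, |y i| ≤ ((40000 * K : ℕ) : ℤ) →
      p (fun i => (y i : ℝ)) ≤ 600 * √K := by
    intro y hy1 hy2
    refine (hp y (hy2.trans (by exact_mod_cast (by omega)))).2.trans ?_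
    have hle : ∑ i, (y i : ℝ) ^ 2 ≤ (200 * √K) ^ 2 := by
      have h : ∑ i, y i ^ 2 ≤ ((40000 * K : ℕ) : ℤ) := by
        refine le_trans (Finset.sum_le_sum fun i _ => ?_) hy2
        rw [← sq_abs, sq]
        exact mul_le_of_le_one_right (abs_nonneg _) (hy1 i)
      have h' : ∑ i, (y i : ℝ) ^ 2 ≤ 40000 * K := by exact_mod_cast h
      calc _ ≤ _ := h'
        _ = (200 * √K) ^ 2 := by rw [mul_pow, hKsq]; norm_num
    have := Real.sqrt_le_sqrt hle
    rw [Real.sqrt_sq (by positivity)] at this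
    linarith
  have hpu : p u ≤ 9 / 200 * n := by
    have h := p.le_of_flat_of_sum (s := 40000 * K) (by omega) (by positivity) hflat u hδpos.le hu1
    have h2 : (∑ i, |u i|) / ((40000 * K : ℕ) : ℝ) ≤ 2 * √K * n / (40000 * √K ^ 2) := by
      rw [hKsq]
      push_cast
      gcongr
    calc p u ≤ _ := h
      _ ≤ (δ + 2 * √K * n / (40000 * √K ^ 2)) * (600 * √K) := by gcongr
      _ = 9 / 200 * n := by rw [hδ]; field_simp; norm_num
  have hpz : δ * √(∑ i, (z i : ℝ) ^ 2) ≤ 27 / 100 * n := by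
    have h1 : p (δ • fun i => (z i : ℝ)) ≤ p u := by
      have : (δ • fun i => (z i : ℝ)) = v - u := by
        ext i
        simp [u]
      rw [this]
      calc p (v - u) ≤ p v + p u := map_sub_le_add p v u
        _ = p u := by rw [hv, zero_add]
    rw [map_smul_eq_mul, Real.norm_of_nonneg hδpos.le] at h1
    have h2 := mul_le_mul_of_nonneg_left (hp z hzsum).1 hδpos.le
    linarith
  have hzsq : δ ^ 2 * ∑ i, (z i : ℝ) ^ 2 ≤ (27 / 100 * n) ^ 2 := by
    have h := pow_le_pow_left₀ (by positivity) hpz 2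
    rwa [mul_pow, Real.sq_sqrt (Finset.sum_nonneg fun i _ => sq_nonneg _)] at h
  have husq : ∑ i, u i ^ 2 ≤ n ^ 2 / 20000 := by
    calc ∑ i, u i ^ 2 ≤ ∑ i, δ * |u i| := by
          refine Finset.sum_le_sum fun i _ => ?_
          rw [← sq_abs, sq]
          exact mul_le_mul_of_nonneg_right (hu1 i) (abs_nonneg _)
      _ = δ * ∑ i, |u i| := by rw [Finset.mul_sum]
      _ ≤ δ * (2 * √K * n) := by gcongr
      _ = n ^ 2 / 20000 := by rw [hδ]; field_simp; norm_num
  -- The two parts have total squared length at most `(2 * 0.0729 + 0.0001) n²`, less than `n²`.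
  have hfin : n ^ 2 ≤ 2 * (δ ^ 2 * ∑ i, (z i : ℝ) ^ 2) + 2 * ∑ i, u i ^ 2 := by
    rw [hnsq, Finset.mul_sum, Finset.mul_sum, Finset.mul_sum, ← Finset.sum_add_distrib]
    refine Finset.sum_le_sum fun i _ => ?_
    have hvi : v i = δ * z i + u i := by simp [u]
    rw [hvi]
    nlinarith [sq_nonneg (δ * z i - u i)]
  nlinarith [sq_pos_of_pos hnpos]

lemma sum_abs_le_of_sum_compl_le {ι : Type*} [Fintype ι] [DecidableEq ι] {K : ℕ} {S : Finset ι}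
    (hS : S.card ≤ K) {v : ι → ℝ} (h : ∑ i ∈ Sᶜ, |v i| ≤ ∑ i ∈ S, |v i|) :
    ∑ i, |v i| ≤ 2 * √K * √(∑ i, v i ^ 2) := by
  have h1 : ∑ i ∈ S, |v i| ≤ √K * √(∑ i, v i ^ 2) := by
    rw [← Real.sqrt_mul (Nat.cast_nonneg K)]
    refine Real.le_sqrt_of_sq_le ?_
    calc (∑ i ∈ S, |v i|) ^ 2 ≤ S.card * ∑ i ∈ S, |v i| ^ 2 := sq_sum_le_card_mul_sum_sq
      _ = S.card * ∑ i ∈ S, v i ^ 2 := by simp only [sq_abs]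
      _ ≤ K * ∑ i, v i ^ 2 := by
        gcongr
        exact Finset.subset_univ S
  rw [← Finset.sum_add_sum_compl S]
  linarith

/-- The null space property implies exact recovery: if `x` is supported on `S` and `x + v` has `ℓ₁` norm
at most that of `x`, then `|v_{Sᶜ}|₁ ≤ |v_S|₁`. -/
lemma recoversExactly_of_nullSpaceProperty {M N K : ℕ} {Φ : Matrix (Fin M) (Fin N) ℝ}
    {B : Matrix (Fin N) (Fin N) ℝ}
    (hnull : ∀ v : Fin N → ℝ, Φ.mulVec (B.mulVec v) = 0 → ∀ S : Finset (Fin N), S.card ≤ K →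
      ∑ i ∈ Sᶜ, |v i| ≤ ∑ i ∈ S, |v i| → v = 0)
    {d : Fin N → ℝ} (hd : IsSparseIn K B d) : RecoversExactly Φ B d := by
  obtain ⟨x, rfl, hx⟩ := hd
  have key : ∀ x' d' : Fin N → ℝ, IsFeasible Φ B (Φ.mulVec (B.mulVec x)) x' d' →
      ∑ i, |x' i| ≤ ∑ i, |x i| → x' = x := by
    rintro x' d' ⟨h1, rfl⟩ hle
    refine sub_eq_zero.1 (hnull (x' - x) ?_ (Finset.univ.filter fun i => x i ≠ 0) hx ?_)
    · rw [Matrix.mulVec_sub, Matrix.mulVec_sub, h1, sub_self]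
    · set S := Finset.univ.filter fun i => x i ≠ 0 with hS
      have hzero : ∀ i ∈ Sᶜ, x i = 0 := fun i hi => by simpa [hS] using hi
      rw [← Finset.sum_add_sum_compl S fun i => |x' i|, ← Finset.sum_add_sum_compl S fun i => |x i|,
        Finset.sum_eq_zero (s := Sᶜ) (f := fun i => |x i|) fun i hi => by rw [hzero i hi, abs_zero]]
        at hle
      have h2 : ∑ i ∈ Sᶜ, |(x' - x) i| = ∑ i ∈ Sᶜ, |x' i| :=
        Finset.sum_congr rfl fun i hi => by rw [Pi.sub_apply, hzero i hi, sub_zero]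
      have h3 : ∑ i ∈ S, |x i| ≤ ∑ i ∈ S, |x' i| + ∑ i ∈ S, |(x' - x) i| := by
        rw [← Finset.sum_add_distrib]
        refine Finset.sum_le_sum fun i _ => ?_
        have := abs_sub (x' i) (x' i - x i)
        rw [sub_sub_cancel] at this
        exact this
      linarith
  have hmin : IsL1Minimizer Φ B (Φ.mulVec (B.mulVec x)) x (B.mulVec x) := by
    refine ⟨⟨rfl, rfl⟩, fun x' d' hf => ?_⟩
    rcases le_total (∑ i, |x' i|) (∑ i, |x i|) with h | h
    · rw [key x' d' hf h]
    · exact h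
  refine ⟨⟨_, _, hmin⟩, fun x' d' h => ?_⟩
  rw [h.1.2, key x' d' h.1 (h.2 _ _ hmin.1)]

/-! ### Counting integer points of an `ℓ₁` ball -/

lemma sum_Icc_inv_pow_natAbs_le {x : ℝ} (hx : 1 < x) (R : ℕ) :
    ∑ k ∈ Finset.Icc (-R : ℤ) R, (x⁻¹) ^ k.natAbs ≤ 1 + 2 / (x - 1) := by
  have hx0 : 0 < x := by linarith
  have hx1 : 0 < x - 1 := by linarith
  -- The second summand is the tail of the geometric series over all of `ℤ`.
  have key : ∑ k ∈ Finset.Icc (-R : ℤ) R, (x⁻¹) ^ k.natAbs + 2 * (x⁻¹) ^ R / (x - 1)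
      = 1 + 2 / (x - 1) := by
    induction R with
    | zero => simp
    | succ R ih =>
      have hset : Finset.Icc (-((R + 1 : ℕ) : ℤ)) ((R + 1 : ℕ) : ℤ)
          = insert (-((R + 1 : ℕ) : ℤ)) (insert ((R + 1 : ℕ) : ℤ) (Finset.Icc (-R : ℤ) R)) := by
        ext k
        simp only [Finset.mem_insert, Finset.mem_Icc]
        omega
      have hn1 : ((R + 1 : ℕ) : ℤ) ∉ Finset.Icc (-R : ℤ) R := by
        simp only [Finset.mem_Icc]
        omega
      have hn2 : (-((R + 1 : ℕ) : ℤ)) ∉ insert ((R + 1 : ℕ) : ℤ) (Finset.Icc (-R : ℤ) R) := by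
        simp only [Finset.mem_insert, Finset.mem_Icc]
        omega
      rw [hset, Finset.sum_insert hn2, Finset.sum_insert hn1, ← ih, Int.natAbs_neg,
        Int.natAbs_natCast, pow_succ]
      field_simp
      ring
  have : 0 ≤ 2 * (x⁻¹) ^ R / (x - 1) := by positivity
  linarith

/-- The integer points of the `ℓ₁` ball of radius `R`. The box `[-R, R]^ι`, which contains all of them,
is there only to obtain a `Finset`. -/
noncomputable def latticeL1Ball (ι : Type*) [Fintype ι] [DecidableEq ι] (R : ℕ) : Finset (ι → ℤ) :=
  (Fintype.piFinset fun _ => Finset.Icc (-R : ℤ) R).filter fun z => ∑ i, |z i| ≤ R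

lemma mem_latticeL1Ball {ι : Type*} [Fintype ι] [DecidableEq ι] {R : ℕ} {z : ι → ℤ} :
    z ∈ latticeL1Ball ι R ↔ ∑ i, |z i| ≤ R := by
  simp only [latticeL1Ball, Finset.mem_filter, Fintype.mem_piFinset, Finset.mem_Icc,
    and_iff_right_iff_imp]
  intro h i
  exact abs_le.1 ((Finset.single_le_sum (fun j _ => abs_nonneg (z j)) (Finset.mem_univ i)).trans h)

/-- Each integer point of the ball satisfies `1 ≤ x ^ R * ∏ i, x ^ (-|z i|)`, and the sum of the
right-hand sides over the box factors into geometric series. -/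
lemma card_latticeL1Ball_le (ι : Type*) [Fintype ι] [DecidableEq ι] (R : ℕ) {x : ℝ} (hx : 1 < x) :
    ((latticeL1Ball ι R).card : ℝ) ≤ x ^ R * (1 + 2 / (x - 1)) ^ Fintype.card ι := by
  have hx0 : 0 < x := by linarith
  have hterm : ∀ z ∈ latticeL1Ball ι R, (1 : ℝ) ≤ x ^ R * ∏ i, (x⁻¹) ^ (z i).natAbs := by
    intro z hz
    have hz' : ∑ i, (z i).natAbs ≤ R := by
      have := mem_latticeL1Ball.1 hz
      simp only [Int.abs_eq_natAbs] at this
      exact_mod_cast this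
    rw [Finset.prod_pow_eq_pow_sum, inv_pow, ← div_eq_mul_inv, one_le_div (by positivity)]
    exact pow_le_pow_right₀ hx.le hz'
  calc ((latticeL1Ball ι R).card : ℝ) = ∑ z ∈ latticeL1Ball ι R, (1 : ℝ) := by simp
    _ ≤ ∑ z ∈ latticeL1Ball ι R, x ^ R * ∏ i, (x⁻¹) ^ (z i).natAbs := Finset.sum_le_sum hterm
    _ ≤ ∑ z ∈ Fintype.piFinset fun _ : ι => Finset.Icc (-R : ℤ) R,
          x ^ R * ∏ i, (x⁻¹) ^ (z i).natAbs :=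
        Finset.sum_le_sum_of_subset_of_nonneg (Finset.filter_subset _ _) fun _ _ _ => by positivity
    _ = x ^ R * ∏ _i : ι, ∑ k ∈ Finset.Icc (-R : ℤ) R, (x⁻¹) ^ k.natAbs := by
        rw [← Finset.mul_sum, Finset.prod_univ_sum]
    _ ≤ x ^ R * (1 + 2 / (x - 1)) ^ Fintype.card ι := by
        rw [Finset.prod_const, Finset.card_univ]
        gcongr
        exact sum_Icc_inv_pow_natAbs_le hx R

/-! ### Orthogonal and Gaussian matrices -/

/-- The seminorm `x ↦ |A x|₂`, with the Euclidean norm on the target. -/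
noncomputable def mulVecSeminorm {m n : Type*} [Fintype m] [Fintype n] (A : Matrix m n ℝ) :
    Seminorm ℝ (n → ℝ) :=
  (normSeminorm ℝ (EuclideanSpace ℝ m)).comp
    ((WithLp.linearEquiv 2 ℝ (m → ℝ)).symm.toLinearMap ∘ₗ A.mulVecLin)

lemma mulVecSeminorm_apply {m n : Type*} [Fintype m] [Fintype n] (A : Matrix m n ℝ) (x : n → ℝ) :
    mulVecSeminorm A x = √(∑ i, (A.mulVec x) i ^ 2) := by
  simp [mulVecSeminorm, EuclideanSpace.norm_eq]

lemma sum_sq_mulVec_of_mem_orthogonalGroup {n : Type*} [Fintype n] [DecidableEq n]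
    {B : Matrix n n ℝ} (hB : B ∈ Matrix.orthogonalGroup n ℝ) (x : n → ℝ) :
    ∑ i, (B.mulVec x) i ^ 2 = ∑ i, x i ^ 2 := by
  have h : ∀ y : n → ℝ, ∑ i, y i ^ 2 = y ⬝ᵥ y := fun y =>
    Finset.sum_congr rfl fun i _ => sq (y i)
  rw [h, h, Matrix.dotProduct_mulVec, Matrix.vecMul_mulVec, ← Matrix.dotProduct_mulVec]
  rw [(Matrix.mem_orthogonalGroup_iff' n ℝ).1 hB, Matrix.one_mulVec]

lemma permMatrix_inv_mul_mem_orthogonalGroup {n : Type*} [Fintype n] [DecidableEq n]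
    (σ : Equiv.Perm n) {Ψ : Matrix n n ℝ} (hΨ : Ψ ∈ Matrix.orthogonalGroup n ℝ) :
    (σ.permMatrix ℝ)⁻¹ * Ψ ∈ Matrix.orthogonalGroup n ℝ := by
  refine mul_mem ?_ hΨ
  have h : σ⁻¹.permMatrix ℝ * σ.permMatrix ℝ = 1 := by
    rw [← Matrix.permMatrix_mul, mul_inv_cancel, Matrix.permMatrix_one]
  rw [Matrix.inv_eq_left_inv h, Matrix.mem_orthogonalGroup_iff,
    Matrix.transpose_permMatrix, inv_inv]
  exact h

/-- A Gaussian matrix with entries of variance `1 / m` distorts the length of a fixed vector by more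
than the factors `1 / 6` and `3` only with probability exponentially small in `m`. -/
lemma measure_gaussian_mulVec_tails_le {Ω m n : Type*} [Fintype m] [Fintype n] [Nonempty m]
    [MeasurableSpace Ω] {μ : Measure Ω} {Φ : Ω → Matrix m n ℝ}
    (hlaw : ∀ i j, HasLaw (fun ω => Φ ω i j) (gaussianReal 0 (1 / (Fintype.card m : ℝ≥0))) μ)
    (hind : iIndepFun (fun (p : m × n) (ω : Ω) => Φ ω p.1 p.2) μ) (w : n → ℝ) :
    μ {ω | ¬ (√(∑ j, w j ^ 2) / 6 ≤ √(∑ i, (Φ ω).mulVec w i ^ 2) ∧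
        √(∑ i, (Φ ω).mulVec w i ^ 2) ≤ 3 * √(∑ j, w j ^ 2))}
      ≤ ENNReal.ofReal (2 * Real.exp (-Fintype.card m)) := by
  have := hind.isProbabilityMeasure
  by_cases hw : w = 0
  · simp [hw]
  set v : ℝ≥0 := 1 / (Fintype.card m : ℝ≥0) * ∑ j, ‖w j‖₊ ^ 2 with hv
  have hcard : (0 : ℝ) < Fintype.card m := by exact_mod_cast Fintype.card_pos
  have hwv : (v : ℝ) * Fintype.card m = ∑ j, w j ^ 2 := by
    rw [hv]
    push_cast
    simp only [Real.norm_eq_abs, sq_abs]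
    field_simp
  have hv0 : v ≠ 0 := by
    intro h0
    rw [h0, NNReal.coe_zero, zero_mul, eq_comm,
      Finset.sum_eq_zero_iff_of_nonneg fun i _ => sq_nonneg _] at hwv
    exact hw (funext fun i => pow_eq_zero_iff two_ne_zero |>.1 (hwv i (Finset.mem_univ i)))
  have hY : ∀ i, HasLaw (fun ω => (Φ ω).mulVec w i) (gaussianReal 0 v) μ := fun i =>
    hasLaw_sum_mul_gaussianReal (hlaw i)
      (hind.precomp (g := fun j => (i, j)) fun _ _ h => congrArg Prod.snd h) w
  have hYind := iIndepFun_rows_mulVec hlaw hind w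
  have h1 := measureReal_sum_sq_gaussianReal_ge hv0 hY hYind
  have h2 := measureReal_sum_sq_gaussianReal_le hv0 hY hYind
  rw [hwv] at h1 h2
  refine (measure_mono (t := {ω | 9 * ∑ j, w j ^ 2 ≤ ∑ i, (Φ ω).mulVec w i ^ 2} ∪
    {ω | ∑ i, (Φ ω).mulVec w i ^ 2 ≤ (∑ j, w j ^ 2) / 36}) ?_).trans ?_
  · intro ω hω
    simp only [Set.mem_ofPred_eq, Set.mem_union] at hω ⊢
    by_contra! hcon
    refine hω ⟨?_, ?_⟩
    · refine Real.le_sqrt_of_sq_le ?_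
      rw [div_pow, Real.sq_sqrt (Finset.sum_nonneg fun i _ => sq_nonneg _)]
      linarith [hcon.2]
    · refine Real.sqrt_le_iff.2 ⟨by positivity, ?_⟩
      rw [mul_pow, Real.sq_sqrt (Finset.sum_nonneg fun i _ => sq_nonneg _)]
      linarith [hcon.1]
  · refine (measure_union_le _ _).trans ?_
    rw [two_mul, ENNReal.ofReal_add (Real.exp_pos _).le (Real.exp_pos _).le]
    exact add_le_add
      ((ENNReal.le_ofReal_iff_toReal_le (measure_ne_top _ _) (Real.exp_pos _).le).2 h1)
      ((ENNReal.le_ofReal_iff_toReal_le (measure_ne_top _ _) (Real.exp_pos _).le).2 h2)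

/-! ### Union bound -/

/-- The condition on `M` makes the lattice small enough for a union bound over events of probability
`e^{-M}`. As `K ≤ κ N`, the terms of order `K` in the exponent are absorbed in `K * log (N / K)` at
the price of the factor `1 / log (1 / κ)`. -/
lemma card_latticeL1Ball_le_exp {κ : ℝ} (hκ : 0 < κ) (hκ1 : κ < 1) {M N K : ℕ} (hK : 1 ≤ K)
    (hKN : (K : ℝ) ≤ κ * N)
    (hM : 2 * (80000 + 160001 / (-Real.log κ)) * (K * Real.log ((N : ℝ) / K)) ≤ M) :
    ((latticeL1Ball (Fin N) (80000 * K)).card : ℝ) ≤ Real.exp (M / 2) := by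
  have hK' : (0 : ℝ) < K := by exact_mod_cast hK
  have hN' : (0 : ℝ) < N := pos_of_mul_pos_right (hK'.trans_le hKN) hκ.le
  have hℓ0 : 0 < -Real.log κ := neg_pos.2 (Real.log_neg hκ hκ1)
  have hℓ : -Real.log κ ≤ Real.log ((N : ℝ) / K) := by
    rw [← Real.log_inv]
    refine Real.log_le_log (by positivity) ?_
    rw [inv_le_comm₀ hκ (by positivity), inv_div, div_le_iff₀ hN']
    exact hKN
  set ℓ := Real.log ((N : ℝ) / K) with hℓdef
  have hNK : (1 : ℝ) ≤ N / K := by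
    rw [one_le_div hK']
    nlinarith
  -- With this `x` the factor `(1 + 2 / (x - 1)) ^ N = (1 + K / N) ^ N` is at most `e ^ K`.
  have h := card_latticeL1Ball_le (Fin N) (80000 * K) (x := 1 + 2 * (N / K))
    (by linarith)
  rw [Fintype.card_fin] at h
  have h1 : (1 + 2 * ((N : ℝ) / K)) ≤ Real.exp (2 + ℓ) := by
    rw [Real.exp_add, hℓdef, Real.exp_log (by positivity)]
    have := Real.add_one_le_exp (2 : ℝ)
    nlinarith
  have h2 : 1 + 2 / (1 + 2 * ((N : ℝ) / K) - 1) ≤ Real.exp (K / N) := by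
    have : 2 / (1 + 2 * ((N : ℝ) / K) - 1) = K / N := by
      rw [add_sub_cancel_left]
      field_simp
    rw [this]
    linarith [Real.add_one_le_exp ((K : ℝ) / N)]
  calc ((latticeL1Ball (Fin N) (80000 * K)).card : ℝ)
      ≤ _ := h
    _ ≤ Real.exp (2 + ℓ) ^ (80000 * K) * Real.exp (K / N) ^ N := by
        have h0 : 0 ≤ 1 + 2 / (1 + 2 * ((N : ℝ) / K) - 1) := by
          rw [add_sub_cancel_left]
          positivity
        gcongr
    _ = Real.exp (80000 * K * (2 + ℓ) + K) := by
        rw [← Real.exp_nat_mul, ← Real.exp_nat_mul, ← Real.exp_add]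
        congr 1
        push_cast
        field_simp
    _ ≤ Real.exp (M / 2) := by
        refine Real.exp_le_exp.2 ?_
        have h3 : (K : ℝ) * 160001 ≤ 160001 / (-Real.log κ) * (K * ℓ) := by
          rw [div_mul_eq_mul_div, le_div_iff₀ hℓ0]
          nlinarith [mul_le_mul_of_nonneg_left hℓ hK'.le]
        linarith

theorem mainTheorem2 :
    ∃ A : ℝ, 0 < A ∧ ∃ c : ℝ, 0 < c ∧
      ∀ κ : ℝ, 0 < κ → κ < 1 → ∃ C : ℝ, 0 < C ∧
        ∀ M N K : ℕ, 1 ≤ K → (K : ℝ) ≤ κ * N →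
          C * (K * Real.log ((N : ℝ) / K)) ≤ M →
          ∀ (σ : Equiv.Perm (Fin N)) (Ψ : Matrix (Fin N) (Fin N) ℝ),
            Ψ ∈ Matrix.orthogonalGroup (Fin N) ℝ →
          ∀ (Ω : Type*) [MeasurableSpace Ω] (μ : Measure Ω) [IsProbabilityMeasure μ]
            (Φ : Ω → Matrix (Fin M) (Fin N) ℝ), IsGaussianSensing μ Φ →
            μ {ω | ¬ ∀ d : Fin N → ℝ,
                IsSparseIn K ((σ.permMatrix ℝ)⁻¹ * Ψ) d →
                  RecoversExactly (Φ ω) ((σ.permMatrix ℝ)⁻¹ * Ψ) d}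
              ≤ ENNReal.ofReal (A * Real.exp (-(c * ((M : ℝ) / N)) * N)) := by
  refine ⟨2, two_pos, 1 / 2, by norm_num, fun κ hκ hκ1 => ?_⟩
  have hℓ0 : 0 < -Real.log κ := neg_pos.2 (Real.log_neg hκ hκ1)
  refine ⟨2 * (80000 + 160001 / (-Real.log κ)), by positivity, ?_⟩
  intro M N K hK hKN hM σ Ψ hΨ Ω _ μ _ Φ hΦ
  have hK' : (0 : ℝ) < K := by exact_mod_cast hK
  have hN' : (0 : ℝ) < N := pos_of_mul_pos_right (hK'.trans_le hKN) hκ.le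
  have hcard := card_latticeL1Ball_le_exp hκ hκ1 hK hKN hM
  have hMpos : 0 < M := by
    have hlog : 0 < Real.log ((N : ℝ) / K) := by
      refine Real.log_pos ?_
      rw [one_lt_div hK']
      nlinarith
    have : (0 : ℝ) < M := lt_of_lt_of_le (by positivity) hM
    exact_mod_cast this
  have : Nonempty (Fin M) := ⟨⟨0, hMpos⟩⟩
  set B := (σ.permMatrix ℝ)⁻¹ * Ψ with hBdef
  have hB : B ∈ Matrix.orthogonalGroup (Fin N) ℝ := permMatrix_inv_mul_mem_orthogonalGroup σ hΨ
  -- `bad z`: the length of `B z` is distorted by more than the factors `1 / 6` and `3`.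
  let bad : (Fin N → ℤ) → Set Ω := fun z =>
    {ω | ¬ (√(∑ j, B.mulVec (fun i => (z i : ℝ)) j ^ 2) / 6 ≤
        √(∑ i, (Φ ω).mulVec (B.mulVec fun i => (z i : ℝ)) i ^ 2) ∧
      √(∑ i, (Φ ω).mulVec (B.mulVec fun i => (z i : ℝ)) i ^ 2) ≤
        3 * √(∑ j, B.mulVec (fun i => (z i : ℝ)) j ^ 2))}
  have hbad : ∀ z, μ (bad z) ≤ ENNReal.ofReal (2 * Real.exp (-M)) := by
    intro z
    have := measure_gaussian_mulVec_tails_le (μ := μ) (Φ := Φ)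
      (by simpa only [Fintype.card_fin] using hΦ.hasLaw) hΦ.indep (B.mulVec fun i => (z i : ℝ))
    simpa only [Fintype.card_fin] using this
  calc _ ≤ μ (⋃ z ∈ latticeL1Ball (Fin N) (80000 * K), bad z) := by
        refine measure_mono fun ω hω => ?_
        by_contra hgood
        simp only [Set.mem_iUnion, not_exists] at hgood
        refine hω fun d hd => recoversExactly_of_nullSpaceProperty (fun v hv S hS hle => ?_) hd
        refine eq_zero_of_lattice_bounds (mulVecSeminorm (Φ ω * B)) hK (fun z hz => ?_) ?_
          (sum_abs_le_of_sum_compl_le hS hle)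
        · have := not_not.1 (hgood z (mem_latticeL1Ball.2 hz))
          rw [sum_sq_mulVec_of_mem_orthogonalGroup hB] at this
          rwa [mulVecSeminorm_apply, ← Matrix.mulVec_mulVec]
        · rw [mulVecSeminorm_apply, ← Matrix.mulVec_mulVec, hv]
          simp
    _ ≤ ∑ z ∈ latticeL1Ball (Fin N) (80000 * K), μ (bad z) := measure_biUnion_finset_le _ _
    _ ≤ ∑ _z ∈ latticeL1Ball (Fin N) (80000 * K), ENNReal.ofReal (2 * Real.exp (-M)) :=
        Finset.sum_le_sum fun z _ => hbad z
    _ = ENNReal.ofReal ((latticeL1Ball (Fin N) (80000 * K)).card * (2 * Real.exp (-M))) := by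
        rw [Finset.sum_const, nsmul_eq_mul, ENNReal.ofReal_mul (Nat.cast_nonneg _),
          ENNReal.ofReal_natCast]
    _ ≤ ENNReal.ofReal (Real.exp (M / 2) * (2 * Real.exp (-M))) := by gcongr
    _ = _ := by
        congr 1
        rw [mul_left_comm, ← Real.exp_add]
        congr 2
        field_simp
        ring
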